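/- Let $R$ be a (possibly noncommutative) ring with $1$ that is both left and right Artinian and in which every left ideal and every right ideal is principal (an Artinian PIR). Let $M$ be a left $R$-module, and let $E(M)$ be an injective envelope of $M$, that is, an injective left $R$-module that is an essential extension of $M$ (every nonzero submodule of $E(M)$ meets $M$ nontrivially). Then $M$ is finitely generated if and only if $E(M)$ is finitely generated. -/

import Mathlib

universe u v w

/-- A submodule `N` of a left `R`-module `E` is essential if it meets every nonzero submodule of
`E` nontrivially. -/
def Submodule.IsEssentialIn {R : Type*} {E : Type*} [Ring R] [AddCommGroup E] [Module R E]
    (N : Submodule R E) : Prop :=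
  ∀ K : Submodule R E, K ≠ ⊥ → N ⊓ K ≠ ⊥

/-- The linear map `i : M → E` exhibits `E` as an injective envelope of the left `R`-module `M`:
`E` is an injective module, `i` is a monomorphism, and `E` is an essential extension of the image
of `i`. The assumption `Small R` says only that the universe of `E` contains a copy of `R`;
it ensures that `Module.Injective R E` (which tests against modules in the universe of `E`)
is injectivity against modules in all universes. -/
structure IsInjectiveEnvelope {R : Type u} {M : Type v} {E : Type w} [Ring R] [Small.{w} R]
    [AddCommGroup M] [Module R M] [AddCommGroup E] [Module R E] (i : M →ₗ[R] E) : Prop where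
  injective_module : Module.Injective R E
  injective_map : Function.Injective i
  essential : (LinearMap.range i).IsEssentialIn

/-- `R` is a (not necessarily commutative) Artinian principal ideal ring: it is left and right
Artinian, and every left ideal and every right ideal is principal. Right ideals of `R` are
treated as left ideals of `Rᵐᵒᵖ`. -/
structure IsArtinianPIR (R : Type*) [Ring R] : Prop where
  left_artinian : IsArtinianRing R
  right_artinian : IsArtinianRing Rᵐᵒᵖ
  left_principal : IsPrincipalIdealRing R
  right_principal : IsPrincipalIdealRing Rᵐᵒᵖ

/-!
The substance is that an Artinian principal ideal ring `R` is left self-injective. By Baer's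
criterion, since left ideals are principal, this amounts to the double annihilator property: if
every `x` with `x * a = 0` satisfies `x * b = 0`, then `b ∈ aR`
(`IsArtinianPIR.exists_eq_mul_right`). By left-right symmetry it is enough to treat the mirror
property, for left ideals.

Suppose that it fails. Replacing `b` by a generator `d` of `Ra + Rb`, there is `Ra ⊊ Rd` where `a`
and `d` have the same right annihilator. Then `IsArtinianPIR.exists_larger` produces a
pair of the same kind on the other side: some `g` with `dR ⊊ gR` such that `d` and `g` have the same
left annihilator. Applied again, on the other side, it yields `h` with `Rg ⊊ Rh` such that `g` and
`h` have the same right annihilator. As `Rd` and `Rg` are both the quotient of `R` by the common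
left annihilator of `d` and `g`, the length of `Rd` is strictly smaller than that of `Rh`. Iterating
contradicts the finiteness of the length of `R`.

Moreover a proper left ideal `Ra` has a nonzero right annihilator, since `R` is right Artinian.
Together with self-injectivity, this shows that linear maps to `R` separate the points of every
module, so a module of finite length embeds in some `Rⁿ`. If `M` is finitely generated, such an
embedding of `M` extends to its injective envelope `E`, the extension is injective by essentiality,
and `E` is finitely generated because `R` is Noetherian. The converse holds since `R` is Noetherian.
-/

/-! ### Ideals of an Artinian principal ideal ring -/

namespace IsArtinianPIR

open MulOpposite

variable {R : Type*} [Ring R]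

protected theorem op (hR : IsArtinianPIR R) : IsArtinianPIR Rᵐᵒᵖ where
  left_artinian := hR.right_artinian
  right_artinian :=
    have := hR.left_artinian
    (RingEquiv.opOp R).surjective.isArtinianRing
  left_principal := hR.right_principal
  right_principal :=
    have := hR.left_principal
    IsPrincipalIdealRing.of_surjective (RingEquiv.opOp R) (RingEquiv.opOp R).surjective

theorem exists_generator (hR : IsArtinianPIR R) (I : Ideal R) :
    ∃ w, ∀ x, x ∈ I ↔ ∃ t, x = t * w := by
  have := hR.left_principal
  obtain ⟨w, hw⟩ := IsPrincipalIdealRing.principal I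
  refine ⟨w, fun x => ?_⟩
  rw [hw, Submodule.mem_span_singleton]
  simp only [smul_eq_mul, eq_comm]

theorem exists_gcd (hR : IsArtinianPIR R) (a b : R) :
    ∃ g, (∃ s, a = s * g) ∧ (∃ t, b = t * g) ∧ ∃ p q, g = p * a + q * b := by
  obtain ⟨g, hg⟩ := hR.exists_generator (Ideal.span {a, b})
  refine ⟨g, (hg a).1 (Ideal.subset_span (by simp)), (hg b).1 (Ideal.subset_span (by simp)), ?_⟩
  obtain ⟨p, q, h⟩ := Ideal.mem_span_pair.1 ((hg g).2 ⟨1, (one_mul g).symm⟩)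
  exact ⟨p, q, h.symm⟩

/-- An element that is not a right zero divisor has a left inverse: by the Artinian condition
the injective map `x ↦ x * w` is onto. -/
theorem exists_mul_eq_one (hR : IsArtinianPIR R) {w : R} (hw : ∀ y, y * w = 0 → y = 0) :
    ∃ v, w * v = 1 := by
  have := hR.left_artinian
  have hinj : Function.Injective (LinearMap.toSpanSingleton R R w) :=
    (injective_iff_map_eq_zero _).2 fun y hy => hw y (by simpa using hy)
  obtain ⟨v, hv⟩ := IsArtinian.surjective_of_injective_endomorphism _ hinj 1
  have hv : v * w = 1 := by simpa using hv
  refine ⟨v, ?_⟩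
  have := hw (w * v - 1) (by rw [sub_mul, mul_assoc, hv]; simp)
  exact sub_eq_zero.1 this

theorem exists_mul_eq_one_op (hR : IsArtinianPIR R) {w : R} (hw : ∀ y, w * y = 0 → y = 0) :
    ∃ v, v * w = 1 := by
  obtain ⟨v, hv⟩ := hR.op.exists_mul_eq_one (w := op w) fun y hy =>
    unop_injective (hw y.unop (op_injective (by simpa using hy)))
  exact ⟨v.unop, op_injective (by simpa using hv)⟩

/-! ### The double annihilator property -/

/-- If `Ra ⊊ Rd` and `a`, `d` have the same right annihilator, then there is `g` with `dR ⊊ gR` such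
that `d`, `g` have the same left annihilator. -/
theorem exists_larger (hR : IsArtinianPIR R) {a d : R} (had : ∃ s, a = s * d)
    (hr : ∀ x, a * x = 0 → d * x = 0) (hda : ¬∃ c, d = c * a) :
    ∃ g, (∃ t, d = g * t) ∧ (∀ x, x * d = 0 → x * g = 0) ∧ ¬∃ c, g = d * c := by
  obtain ⟨s, rfl⟩ := had
  -- `w` generates the left ideal `Rs + l(d)`, so that `Rwd = Ra`.
  obtain ⟨w, hw⟩ := hR.exists_generator
    (Ideal.span {s} ⊔ LinearMap.ker (LinearMap.toSpanSingleton R R d))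
  obtain ⟨u, hu⟩ := (hw s).1 (Ideal.mem_sup_left (Ideal.mem_span_singleton_self s))
  have hann (x : R) (hx : x * d = 0) : ∃ t, x = t * w :=
    (hw x).1 (Ideal.mem_sup_right (by simpa using hx))
  obtain ⟨s', hs', z, hz, hsz⟩ := Submodule.mem_sup.1 ((hw w).2 ⟨1, (one_mul w).symm⟩)
  obtain ⟨p, rfl⟩ := Ideal.mem_span_singleton'.1 hs'
  have hz : z * d = 0 := by simpa using hz
  have hwd : w * d = p * (s * d) := by rw [← hsz, add_mul, hz, add_zero, mul_assoc]
  -- As `Ra ≠ Rd`, the element `w` has no left inverse, hence it is a left zero divisor.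
  obtain ⟨y, hwy, hy⟩ : ∃ y, w * y = 0 ∧ y ≠ 0 := by
    by_contra! h
    obtain ⟨v, hv⟩ := hR.exists_mul_eq_one_op h
    refine hda ⟨v * p, ?_⟩
    rw [mul_assoc, ← hwd, ← mul_assoc, hv, one_mul]
  obtain ⟨g, ⟨t, ht⟩, ⟨t', ht'⟩, p', q, hg⟩ := hR.op.exists_gcd (op d) (op y)
  have ht : d = g.unop * t.unop := op_injective (by simpa using ht)
  have ht' : y = g.unop * t'.unop := op_injective (by simpa using ht')
  have hg : g.unop = d * p'.unop + y * q.unop := op_injective (by simpa using hg)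
  refine ⟨g.unop, ⟨_, ht⟩, fun x hx => ?_, ?_⟩
  · obtain ⟨k, hk⟩ := hann x hx
    have hxy : x * y = 0 := by rw [hk, mul_assoc, hwy, mul_zero]
    rw [hg, mul_add, ← mul_assoc, ← mul_assoc, hx, hxy, zero_mul, zero_mul, add_zero]
  · rintro ⟨c, hc⟩
    have hyd : y = d * (c * t'.unop) := by rw [← mul_assoc, ← hc, ← ht']
    refine hy (hyd.trans (hr _ ?_))
    rw [hu, mul_assoc u, mul_assoc u, mul_assoc w, ← hyd, hwy, mul_zero]

theorem exists_larger_op (hR : IsArtinianPIR R) {a d : R} (had : ∃ s, a = d * s)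
    (hl : ∀ x, x * a = 0 → x * d = 0) (hda : ¬∃ c, d = a * c) :
    ∃ g, (∃ t, d = t * g) ∧ (∀ x, d * x = 0 → g * x = 0) ∧ ¬∃ c, g = c * d := by
  obtain ⟨s, hs⟩ := had
  obtain ⟨g, ⟨t, ht⟩, hg, hgd⟩ := hR.op.exists_larger (a := op a) (d := op d)
    ⟨op s, by simp [hs]⟩
    (fun x hx => unop_injective (hl x.unop (op_injective (by simpa using hx))))
    (fun ⟨c, hc⟩ => hda ⟨c.unop, op_injective (by simpa using hc)⟩)
  exact ⟨g.unop, ⟨t.unop, op_injective (by simpa using ht)⟩,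
    fun x hx => op_injective (by simpa using hg (op x) (by rw [← op_mul, hx, op_zero])),
    fun ⟨c, hc⟩ => hgd ⟨op c, unop_injective (by simpa using hc)⟩⟩

/-- Elements with the same left annihilator generate left ideals of the same length. -/
theorem length_span_singleton_eq {d g : R} (h : ∀ x, x * d = 0 ↔ x * g = 0) :
    Module.length R (Ideal.span {d}) = Module.length R (Ideal.span {g}) := by
  have key (a : R) : Module.length R (Ideal.span {a}) =
      Module.length R (R ⧸ LinearMap.ker (LinearMap.toSpanSingleton R R a)) := by
    rw [(LinearMap.toSpanSingleton R R a).quotKerEquivRange.length_eq,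
      LinearMap.range_toSpanSingleton]
  have hker : LinearMap.ker (LinearMap.toSpanSingleton R R d) =
      LinearMap.ker (LinearMap.toSpanSingleton R R g) := by
    ext x
    simpa using h x
  rw [key, key, hker]

/-- The double annihilator property for principal left ideals. -/
theorem exists_eq_mul_left (hR : IsArtinianPIR R) {a b : R} (h : ∀ x, a * x = 0 → b * x = 0) :
    ∃ c, b = c * a := by
  have := hR.left_artinian
  by_contra hba
  -- `P d` says that some `Ra' ⊊ Rd` has the same right annihilator as `Rd`.
  let P (d : R) : Prop :=
    ∃ a', (∃ s, a' = s * d) ∧ (∀ x, a' * x = 0 → d * x = 0) ∧ ¬∃ c, d = c * a'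
  have step (d : R) (hd : P d) : ∃ e, P e ∧
      Module.length R (Ideal.span {d}) < Module.length R (Ideal.span {e}) := by
    obtain ⟨a', h₁, h₂, h₃⟩ := hd
    obtain ⟨g, ⟨t, ht⟩, hg, hgd⟩ := hR.exists_larger h₁ h₂ h₃
    obtain ⟨e, ⟨u, hu⟩, he, heg⟩ := hR.exists_larger_op ⟨t, ht⟩ hg hgd
    refine ⟨e, ⟨g, ⟨u, hu⟩, he, heg⟩, ?_⟩
    rw [length_span_singleton_eq (d := d) (g := g)
      fun x => ⟨hg x, fun hx => by rw [ht, ← mul_assoc, hx, zero_mul]⟩,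
      Module.length_submodule, Module.length_submodule]
    refine Submodule.height_strictMono (lt_of_le_of_ne ?_ fun heq => heg ?_)
    · rw [Ideal.span_singleton_le_iff_mem]
      exact Ideal.mem_span_singleton'.2 ⟨u, hu.symm⟩
    · obtain ⟨c, hc⟩ := Ideal.mem_span_singleton'.1
        (heq ▸ Ideal.mem_span_singleton_self e : e ∈ Ideal.span {g})
      exact ⟨c, hc.symm⟩
  have unbounded (n : ℕ) : ∃ d, P d ∧ (n : ℕ∞) ≤ Module.length R (Ideal.span {d}) := by
    induction n with
    | zero =>
      obtain ⟨d, ⟨s, hs⟩, ⟨t, ht⟩, p, q, hd⟩ := hR.exists_gcd a b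
      refine ⟨d, ⟨a, ⟨s, hs⟩, fun x hx => ?_, fun ⟨c, hc⟩ => hba ⟨t * c, ?_⟩⟩, by simp⟩
      · rw [hd, add_mul, mul_assoc, mul_assoc, hx, h x hx, mul_zero, mul_zero, add_zero]
      · rw [mul_assoc, ← hc, ← ht]
    | succ n ih =>
      obtain ⟨d, hd, hn⟩ := ih
      obtain ⟨e, he, hlt⟩ := step d hd
      refine ⟨e, he, ?_⟩
      push_cast
      exact Order.add_one_le_of_lt (hn.trans_lt hlt)
  obtain ⟨n, hn⟩ := ENat.ne_top_iff_exists.1 (Module.length_ne_top (R := R) (M := R))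
  obtain ⟨d, -, hd⟩ := unbounded (n + 1)
  have hle : Module.length R (Ideal.span {d}) ≤ Module.length R R :=
    Module.length_le_of_injective (Ideal.span {d}).subtype Subtype.val_injective
  have := hd.trans hle
  rw [← hn] at this
  norm_cast at this
  omega

/-- The double annihilator property for principal right ideals. -/
theorem exists_eq_mul_right (hR : IsArtinianPIR R) {a b : R} (h : ∀ x, x * a = 0 → x * b = 0) :
    ∃ c, b = a * c := by
  obtain ⟨c, hc⟩ := hR.op.exists_eq_mul_left (a := op a) (b := op b) fun x hx =>
    unop_injective (h x.unop (op_injective (by simpa using hx)))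
  exact ⟨c.unop, op_injective (by simpa using hc)⟩

/-! ### Self-injectivity and embeddings into free modules -/

/-- An Artinian principal ideal ring is left self-injective. -/
theorem baer_self (hR : IsArtinianPIR R) : Module.Baer R R := by
  intro I f
  obtain ⟨a, ha⟩ := hR.exists_generator I
  have haI : a ∈ I := (ha a).2 ⟨1, (one_mul a).symm⟩
  obtain ⟨c, hc⟩ := hR.exists_eq_mul_right (a := a) (b := f ⟨a, haI⟩) fun x hx => by
    rw [← smul_eq_mul, ← map_smul]
    convert map_zero f
    simpa using hx
  refine ⟨LinearMap.toSpanSingleton R R c, fun x hx => ?_⟩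
  obtain ⟨t, rfl⟩ := (ha x).1 hx
  have : (⟨t * a, hx⟩ : I) = t • ⟨a, haI⟩ := rfl
  rw [this, map_smul, hc]
  simp [mul_assoc]

/-- Linear maps to `R` separate the points of every left `R`-module. -/
theorem exists_linearMap_ne_zero (hR : IsArtinianPIR R) {M : Type*} [AddCommGroup M] [Module R M]
    {m : M} (hm : m ≠ 0) : ∃ f : M →ₗ[R] R, f m ≠ 0 := by
  let ι := LinearMap.toSpanSingleton R M m
  obtain ⟨a, ha⟩ := hR.exists_generator (LinearMap.ker ι)
  have ham : a • m = 0 := by simpa [ι] using (ha a).2 ⟨1, (one_mul a).symm⟩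
  obtain ⟨y, hay, hy⟩ : ∃ y, a * y = 0 ∧ y ≠ 0 := by
    by_contra! h
    obtain ⟨v, hv⟩ := hR.exists_mul_eq_one_op h
    exact hm (by rw [← one_smul R m, ← hv, mul_smul, ham, smul_zero])
  -- The map `r • m ↦ r * y` on `Rm` is well defined, and extends to `M`.
  have hker : LinearMap.ker ι ≤ LinearMap.ker (LinearMap.toSpanSingleton R R y) := fun x hx => by
    obtain ⟨t, rfl⟩ := (ha x).1 hx
    simp [mul_assoc, hay]
  obtain ⟨f, hf⟩ := hR.baer_self.extension_property ((LinearMap.ker ι).liftQ ι le_rfl)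
    (LinearMap.ker_eq_bot.1 (Submodule.ker_liftQ_eq_bot' _ _ rfl))
    ((LinearMap.ker ι).liftQ _ hker)
  refine ⟨f, ?_⟩
  have := LinearMap.congr_fun hf (Submodule.Quotient.mk 1)
  simp only [LinearMap.comp_apply, Submodule.liftQ_apply, ι, LinearMap.toSpanSingleton_apply,
    one_smul] at this
  rwa [this]

/-- A left `R`-module of finite length embeds in a finite free module: among the maps `M → Rⁿ` one
with minimal kernel is injective. -/
theorem exists_injective_linearMap_pi (hR : IsArtinianPIR R) {M : Type*} [AddCommGroup M]
    [Module R M] [IsArtinian R M] :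
    ∃ (n : ℕ) (f : M →ₗ[R] (Fin n → R)), Function.Injective f := by
  obtain ⟨_, ⟨⟨n, f⟩, rfl⟩, hmin⟩ := IsArtinian.set_has_minimal
    (Set.range fun p : Σ n : ℕ, M →ₗ[R] (Fin n → R) => LinearMap.ker p.2) ⟨_, ⟨0, 0⟩, rfl⟩
  refine ⟨n, f, (injective_iff_map_eq_zero f).2 fun m hfm => ?_⟩
  by_contra hm
  obtain ⟨φ, hφ⟩ := hR.exists_linearMap_ne_zero hm
  let f' : M →ₗ[R] (Fin (n + 1) → R) :=
    LinearMap.pi (Fin.cons φ fun j => LinearMap.proj j ∘ₗ f)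
  have hf' (x : M) : f' x = Fin.cons (φ x) (f x) := by
    ext j
    cases j using Fin.cases <;> simp [f']
  have hf'_zero (x : M) (hx : f' x = 0) : φ x = 0 ∧ f x = 0 := by
    rw [hf'] at hx
    exact ⟨congr_fun hx 0, funext fun j => by simpa using congr_fun hx j.succ⟩
  refine hmin _ ⟨⟨n + 1, f'⟩, rfl⟩ (lt_of_le_of_ne (fun x hx => (hf'_zero x hx).2) fun heq => ?_)
  have : m ∈ LinearMap.ker f' := heq.ge hfm
  exact hφ (hf'_zero m this).1

end IsArtinianPIR

/-! ### Injective envelopes -/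

theorem theorem4p8 {R : Type u} [Ring R] (hR : IsArtinianPIR R)
    {M : Type v} [AddCommGroup M] [Module R M]
    {E : Type w} [Small.{w} R] [AddCommGroup E] [Module R E]
    (i : M →ₗ[R] E) (hi : IsInjectiveEnvelope i) :
    Module.Finite R M ↔ Module.Finite R E := by
  have := hR.left_artinian
  refine ⟨fun _ => ?_, fun _ => Module.Finite.of_injective i hi.injective_map⟩
  obtain ⟨n, f, hf⟩ := hR.exists_injective_linearMap_pi (M := M)
  choose F hF using fun j =>
    hR.baer_self.extension_property i hi.injective_map (LinearMap.proj j ∘ₗ f)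
  have hFi (m : M) : LinearMap.pi F (i m) = f m :=
    funext fun j => LinearMap.congr_fun (hF j) m
  refine Module.Finite.of_injective (LinearMap.pi F) (LinearMap.ker_eq_bot.1 ?_)
  by_contra hne
  refine hi.essential _ hne (eq_bot_iff.2 ?_)
  rintro _ ⟨⟨m, rfl⟩, hm⟩
  have hfm : f m = 0 := (hFi m).symm.trans hm
  rw [(injective_iff_map_eq_zero f).1 hf m hfm, map_zero]
  exact Submodule.zero_mem _
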